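/- Let $\mathbb K$ be $\mathbb R$ or $\mathbb C$ and let $n$ be a natural number. For a Banach space $E$ over $\mathbb K$ let $\mathcal P^n(E)$ be the space of continuous $n$-homogeneous polynomials $P:E\to\mathbb K$, i.e. $P(x)=A(x,\dots,x)$ for a (unique) continuous symmetric $n$-linear form $A$ on $E$. A Banach ideal of $n$-homogeneous polynomials is a pair $(\mathcal Q,\|\cdot\|_{\mathcal Q})$ assigning to each Banach space $E$ a linear subspace $\mathcal Q(E)\subseteq\mathcal P^n(E)$ with a norm $\|\cdot\|_{\mathcal Q(E)}$ that makes it a Banach space, such that (i) if $T:E_1\to E$ is a bounded operator and $P\in\mathcal Q(E)$, then $P\circ T\in\mathcal Q(E_1)$ and $\|P\circ T\|_{\mathcal Q(E_1)}\le\|P\|_{\mathcal Q(E)}\|T\|^n$; (ii) $z\mapsto z^n$ belongs to $\mathcal Q(\mathbb K)$ and has norm $1$ there. The minimal kernel $\mathcal Q^{\min}$ of $\mathcal Q$ consists of the polynomials $P:E\to\mathbb K$ that admit a factorization $P=R\circ T$ through a Banach space $F$, with $T:E\to F$ an approximable operator (an operator-norm limit of finite rank operators) and $R\in\mathcal Q(F)$;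 its norm is $\|P\|_{\mathcal Q^{\min}(E)}=\inf\|R\|_{\mathcal Q(F)}\|T\|^n$, the infimum being taken over all such factorizations. The ideal $\mathcal Q$ is called minimal if $\mathcal Q(E)=\mathcal Q^{\min}(E)$ with equal norms for every Banach space $E$. For an ultrafilter $\mathfrak U$ on a set $I$, the ultrapower $(E)_{\mathfrak U}$ is the Banach space of classes $(z_i)_{\mathfrak U}$ of bounded families $(z_i)_{i\in I}$ in $E$, two families $(z_i)$, $(y_i)$ being identified if $\lim_{i,\mathfrak U}\|z_i-y_i\|=0$, with the norm $\|(z_i)_{\mathfrak U}\|=\lim_{i,\mathfrak U}\|z_i\|$. The iterated extension of $P\in\mathcal P^n(E)$, with associated symmetric $n$-linear form $A$, is the function $\overline P:(E)_{\mathfrak U}\to\mathbb K$ given by $$\overline P\big((z_i)_{\mathfrak U}\big)=\lim_{i_1,\mathfrak U}\cdots\lim_{i_n,\mathfrak U}A(z_{i_1},\dots,z_{i_n}).$$ **Theorem.** Let $\mathcal Q$ be a minimal Banach ideal of $n$-homogeneous polynomials, let $E$ be a Banach space, let $\mathfrak U$ be an ultrafilter on a set $I$, and let $P\in\mathcal Q(E)$.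 Then the iterated extension $\overline P$ belongs to $\mathcal Q((E)_{\mathfrak U})$ and $$\|P\|_{\mathcal Q(E)}=\|\overline P\|_{\mathcal Q((E)_{\mathfrak U})}.$$ -/

import Mathlib

open Filter Topology
open scoped ENNReal

universe u v

noncomputable section

namespace PolyIdeals

/-! ### Continuous homogeneous polynomials -/

section Polynomials

variable (𝕜 : Type v) [RCLike 𝕜] (n : ℕ)
variable (E : Type u) [NormedAddCommGroup E] [NormedSpace 𝕜 E]

/-- The restriction of a continuous `n`-linear form to the diagonal, `x ↦ A (x, …, x)`. -/
def diagonal : ContinuousMultilinearMap 𝕜 (fun _ : Fin n => E) 𝕜 →ₗ[𝕜] (E → 𝕜) where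
  toFun A := fun x => A fun _ => x
  map_add' _ _ := rfl
  map_smul' _ _ := rfl

/-- The space of continuous scalar valued `n`-homogeneous polynomials on `E`. -/
def HomPoly : Submodule 𝕜 (E → 𝕜) := LinearMap.range (diagonal 𝕜 n E)

variable {𝕜 n E}

/-- An `n`-linear form is symmetric if it is invariant under permutations of its arguments. -/
def IsSymmForm (A : ContinuousMultilinearMap 𝕜 (fun _ : Fin n => E) 𝕜) : Prop :=
  ∀ (σ : Equiv.Perm (Fin n)) (x : Fin n → E), A (fun j => x (σ j)) = A x

/-- A continuous `n`-homogeneous polynomial is the diagonal of exactly one symmetric form. -/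
theorem existsUnique_symmForm {P : E → 𝕜} (hP : P ∈ HomPoly 𝕜 n E) :
    ∃! A : ContinuousMultilinearMap 𝕜 (fun _ : Fin n => E) 𝕜,
      IsSymmForm A ∧ ∀ x, A (fun _ => x) = P x := by
  obtain ⟨B, rfl⟩ := hP
  have hn : ((n.factorial : ℕ) : 𝕜) ≠ 0 := by exact_mod_cast n.factorial_ne_zero
  refine ⟨((n.factorial : ℕ) : 𝕜)⁻¹ • ∑ σ : Equiv.Perm (Fin n), B.domDomCongr σ, ⟨?_, ?_⟩, ?_⟩
  · intro τ x
    simp only [smul_apply, sum_apply,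
      ContinuousMultilinearMap.domDomCongr_apply]
    congr 1
    exact Fintype.sum_equiv (Equiv.mulLeft τ) _ _ fun σ => rfl
  · intro x
    simp [diagonal, Fintype.card_perm, hn]
  · rintro A ⟨hA, hAB⟩
    have key : ∀ C : ContinuousMultilinearMap 𝕜 (fun _ : Fin n => E) 𝕜, ∀ v : Fin n → E,
        iteratedFDeriv 𝕜 n (fun x => C fun _ => x) 0 v
          = ∑ σ : Equiv.Perm (Fin n), C (fun i => v (σ i)) := fun C v => by
      rw [C.iteratedFDeriv_comp_diagonal]
    ext v
    have h1 := key A v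
    have h2 := key B v
    have hfun : (fun x => A fun _ => x) = fun x => B fun _ => x := funext hAB
    rw [hfun, h2] at h1
    have h3 : ∑ σ : Equiv.Perm (Fin n), A (fun i => v (σ i)) = (n.factorial : 𝕜) * A v := by
      simp [hA _ v, Fintype.card_perm]
    rw [h3] at h1
    simp only [smul_apply, sum_apply,
      ContinuousMultilinearMap.domDomCongr_apply, smul_eq_mul, h1]
    field_simp

/-- The symmetric `n`-linear form associated with a continuous `n`-homogeneous polynomial. -/
def symmForm {P : E → 𝕜} (hP : P ∈ HomPoly 𝕜 n E) :
    ContinuousMultilinearMap 𝕜 (fun _ : Fin n => E) 𝕜 :=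
  (existsUnique_symmForm hP).choose

end Polynomials

/-! ### Approximable operators -/

/-- An operator is approximable if it is a limit, in operator norm, of finite rank operators. -/
def IsApproximable {𝕜 : Type v} [RCLike 𝕜] {E F : Type u}
    [NormedAddCommGroup E] [NormedSpace 𝕜 E] [NormedAddCommGroup F] [NormedSpace 𝕜 F]
    (T : E →L[𝕜] F) : Prop :=
  T ∈ closure {S : E →L[𝕜] F | FiniteDimensional 𝕜 (LinearMap.range (S : E →ₗ[𝕜] F))}

/-! ### Ultrapowers -/

section Ultrapowers

variable (𝕜 : Type v) [RCLike 𝕜] {I : Type u} (𝔘 : Ultrafilter I)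
variable (E : Type u) [NormedAddCommGroup E] [NormedSpace 𝕜 E]

/-- The bounded families `(z i)` in `E` with `lim_𝔘 ‖z i‖ = 0`. -/
def nullFamilies : Submodule 𝕜 (lp (fun _ : I => E) ∞) where
  carrier := {z | Tendsto (fun i => ‖z i‖) 𝔘 (𝓝 0)}
  zero_mem' := by simp
  add_mem' {z w} hz hw := by
    refine squeeze_zero (fun _ => norm_nonneg _) (fun i => ?_) (by simpa using hz.add hw)
    simpa using norm_add_le (z i) (w i)
  smul_mem' c z hz := by
    simpa [norm_smul] using hz.const_mul ‖c‖

instance isClosed_nullFamilies :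
    IsClosed (nullFamilies 𝕜 𝔘 E : Set (lp (fun _ : I => E) ∞)) := by
  refine isClosed_of_closure_subset fun z hz => ?_
  change Tendsto (fun i => ‖z i‖) 𝔘 (𝓝 0)
  rw [Metric.tendsto_nhds]
  intro ε hε
  obtain ⟨w, hw, hzw⟩ := Metric.mem_closure_iff.1 hz (ε / 2) (half_pos hε)
  filter_upwards [(Metric.tendsto_nhds.1 hw) (ε / 2) (half_pos hε)] with i hi
  have h1 : ‖z i - w i‖ ≤ ‖z - w‖ := lp.norm_apply_le_norm (by simp) (z - w) i
  have h2 : ‖z i‖ ≤ ‖z i - w i‖ + ‖w i‖ := by simpa using norm_add_le (z i - w i) (w i)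
  rw [dist_eq_norm] at hzw
  simp only [dist_zero_right, norm_norm] at hi ⊢
  linarith

/-- The ultrapower `(E)_𝔘`: bounded families in `E`, two families being identified if
`lim_𝔘 ‖z i - y i‖ = 0`. Its norm is the quotient norm, which is `lim_𝔘 ‖z i‖` by
`tendsto_norm_mk` below. -/
abbrev Ultrapower : Type u := lp (fun _ : I => E) ∞ ⧸ nullFamilies 𝕜 𝔘 E

variable {𝕜 E}

/-- The norm of the class of a family `z` is `lim_𝔘 ‖z i‖`. -/
theorem tendsto_norm_mk (z : lp (fun _ : I => E) ∞) :
    Tendsto (fun i => ‖z i‖) 𝔘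
      (𝓝 ‖(Submodule.Quotient.mk z : Ultrapower 𝕜 𝔘 E)‖) := by
  have hbd : ∀ i, ‖z i‖ ≤ ‖z‖ := fun i => lp.norm_apply_le_norm (by simp) z i
  obtain ⟨L, hLmem, hL⟩ := (isCompact_Icc (a := (0 : ℝ)) (b := ‖z‖)).ultrafilter_le_nhds
    (𝔘.map fun i => ‖z i‖) (by
      rw [Ultrafilter.coe_map, le_principal_iff]
      exact mem_map.2 (univ_mem' fun i => ⟨norm_nonneg (z i), hbd i⟩))
  have hT : Tendsto (fun i => ‖z i‖) 𝔘 (𝓝 L) := hL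
  suffices h : ‖(Submodule.Quotient.mk z : Ultrapower 𝕜 𝔘 E)‖ = L by rwa [h]
  apply le_antisymm
  · refine le_of_forall_pos_le_add fun ε hε => ?_
    classical
    let w : lp (fun _ : I => E) ∞ :=
      ⟨fun i => if ‖z i‖ ≤ L + ε then z i else 0, memℓp_infty ⟨‖z‖, by
        rintro _ ⟨i, rfl⟩
        dsimp only
        split_ifs
        · exact hbd i
        · simp⟩⟩
    have hw : ∀ i, w i = if ‖z i‖ ≤ L + ε then z i else 0 := fun _ => rfl
    have hzw : (Submodule.Quotient.mk z : Ultrapower 𝕜 𝔘 E) = Submodule.Quotient.mk w := by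
      rw [Submodule.Quotient.eq]
      refine tendsto_const_nhds.congr' ?_
      filter_upwards [hT.eventually (ge_mem_nhds (lt_add_of_pos_right L hε))] with i hi
      simp [hw, hi]
    rw [hzw]
    refine (Submodule.Quotient.norm_mk_le _ w).trans
      (lp.norm_le_of_forall_le (by linarith [hLmem.1]) fun i => ?_)
    rw [hw]
    split_ifs with h
    · exact h
    · simpa using by linarith [hLmem.1]
  · refine le_of_forall_pos_le_add fun ε hε => ?_
    obtain ⟨w, hw, hlt⟩ := Submodule.Quotient.norm_mk_lt
      (Submodule.Quotient.mk z : Ultrapower 𝕜 𝔘 E) hε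
    have hzw : Tendsto (fun i => ‖(z - w) i‖) 𝔘 (𝓝 0) :=
      (Submodule.Quotient.eq (nullFamilies 𝕜 𝔘 E)).1 hw.symm
    refine le_trans ?_ hlt.le
    have h0 : Tendsto (fun i => ‖z i‖ - ‖(z - w) i‖) 𝔘 (𝓝 (L - 0)) := hT.sub hzw
    rw [sub_zero] at h0
    refine le_of_tendsto h0 (Eventually.of_forall fun i => ?_)
    have h1 : ‖w i‖ ≤ ‖w‖ := lp.norm_apply_le_norm (by simp) w i
    have h2 : ‖z i‖ ≤ ‖(z - w) i‖ + ‖w i‖ := by simpa using norm_add_le (z i - w i) (w i)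
    linarith

/-- The iterated limit `lim_{i₁,𝔘} ⋯ lim_{iₙ,𝔘} f (i₁, …, iₙ)`; the limit over the first index is
the outermost one. -/
def iteratedLim : (n : ℕ) → ((Fin n → I) → 𝕜) → 𝕜
  | 0, f => f Fin.elim0
  | n + 1, f => limUnder (𝔘 : Filter I) fun i => iteratedLim n fun s => f (Fin.cons i s)

/-- Bounded scalar families converge along an ultrafilter. -/
theorem tendsto_limUnder_of_bounded {g : I → 𝕜} {C : ℝ} (hg : ∀ i, ‖g i‖ ≤ C) :
    Tendsto g 𝔘 (𝓝 (limUnder (𝔘 : Filter I) g)) := by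
  obtain ⟨a, -, ha⟩ := (isCompact_closedBall (0 : 𝕜) C).ultrafilter_le_nhds (𝔘.map g) (by
    rw [Ultrafilter.coe_map, le_principal_iff]
    exact mem_map.2 (univ_mem' fun i => by simpa using hg i))
  exact tendsto_nhds_limUnder ⟨a, ha⟩

theorem norm_iteratedLim_le {C : ℝ} : ∀ {n : ℕ} {f : (Fin n → I) → 𝕜}, (∀ s, ‖f s‖ ≤ C) →
    ‖iteratedLim 𝔘 n f‖ ≤ C
  | 0, _, hf => hf _
  | n + 1, f, hf => by
    have h : ∀ i, ‖iteratedLim 𝔘 n fun s => f (Fin.cons i s)‖ ≤ C := fun i =>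
      norm_iteratedLim_le fun s => hf _
    exact le_of_tendsto (tendsto_limUnder_of_bounded 𝔘 h).norm (Eventually.of_forall h)

theorem iteratedLim_sub {C D : ℝ} : ∀ {n : ℕ} {f g : (Fin n → I) → 𝕜}, (∀ s, ‖f s‖ ≤ C) →
    (∀ s, ‖g s‖ ≤ D) →
    iteratedLim 𝔘 n (fun s => f s - g s) = iteratedLim 𝔘 n f - iteratedLim 𝔘 n g
  | 0, _, _, _, _ => rfl
  | n + 1, f, g, hf, hg => by
    have h1 := tendsto_limUnder_of_bounded 𝔘 fun i =>
      norm_iteratedLim_le (f := fun s => f (Fin.cons i s)) 𝔘 fun s => hf _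
    have h2 := tendsto_limUnder_of_bounded 𝔘 fun i =>
      norm_iteratedLim_le (f := fun s => g (Fin.cons i s)) 𝔘 fun s => hg _
    refine Tendsto.limUnder_eq ((h1.sub h2).congr fun i => ?_)
    exact (iteratedLim_sub (fun s => hf _) fun s => hg _).symm

/-- The iterated limit of `Φ` along bounded families depends only on their classes. -/
theorem iteratedLim_congr : ∀ {n : ℕ} (Φ : ContinuousMultilinearMap 𝕜 (fun _ : Fin n => E) 𝕜)
    (z w : Fin n → lp (fun _ : I => E) ∞), (∀ j, z j - w j ∈ nullFamilies 𝕜 𝔘 E) →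
    iteratedLim 𝔘 n (fun s => Φ fun j => z j (s j)) =
      iteratedLim 𝔘 n (fun s => Φ fun j => w j (s j))
  | 0, Φ, z, w, _ => congrArg Φ (Subsingleton.elim _ _)
  | n + 1, Φ, z, w, h => by
    have hcons : ∀ (y : Fin (n + 1) → lp (fun _ : I => E) ∞) (i : I) (s : Fin n → I),
        (Φ fun j => y j ((Fin.cons i s : Fin (n + 1) → I) j)) =
          Φ.curryLeft (y 0 i) fun j => y j.succ (s j) := fun y i s => by
      rw [ContinuousMultilinearMap.curryLeft_apply]
      congr 1
      funext j
      refine Fin.cases ?_ (fun j => ?_) j <;> simp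
    have hbd : ∀ (x : E) (s : Fin n → I),
        ‖Φ.curryLeft x fun j => w j.succ (s j)‖ ≤ ‖Φ.curryLeft‖ * ‖x‖ * ∏ j : Fin n, ‖w j.succ‖ :=
      fun x s => by
        refine (ContinuousMultilinearMap.le_opNorm _ _).trans ?_
        gcongr
        · exact Φ.curryLeft.le_opNorm x
        · exact lp.norm_apply_le_norm (by simp) _ _
    let G : E → 𝕜 := fun x => iteratedLim 𝔘 n fun s => Φ.curryLeft x fun j => w j.succ (s j)
    have hG : ∀ x y : E, ‖G x - G y‖ ≤ ‖Φ.curryLeft‖ * ‖x - y‖ * ∏ j : Fin n, ‖w j.succ‖ := by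
      intro x y
      rw [← iteratedLim_sub 𝔘 (hbd x) (hbd y)]
      refine norm_iteratedLim_le 𝔘 fun s => ?_
      rw [← sub_apply, ← map_sub]
      exact hbd _ s
    have hw : Tendsto (fun i => G (w 0 i)) 𝔘 (𝓝 (limUnder (𝔘 : Filter I) fun i => G (w 0 i))) := by
      refine tendsto_limUnder_of_bounded (C := ‖Φ.curryLeft‖ * ‖w 0‖ * ∏ j : Fin n, ‖w j.succ‖) 𝔘
        fun i => norm_iteratedLim_le 𝔘 fun s => (hbd _ s).trans ?_
      gcongr
      exact lp.norm_apply_le_norm (by simp) _ _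
    have h0 : Tendsto (fun i => G (z 0 i) - G (w 0 i)) 𝔘 (𝓝 0) := by
      have h1 : Tendsto (fun i => ‖z 0 i - w 0 i‖) 𝔘 (𝓝 0) := h 0
      refine squeeze_zero_norm (fun i => hG _ _) ?_
      simpa using (h1.const_mul ‖Φ.curryLeft‖).mul_const (∏ j : Fin n, ‖w j.succ‖)
    have hz : limUnder (𝔘 : Filter I) (fun i => G (z 0 i)) =
        limUnder (𝔘 : Filter I) fun i => G (w 0 i) :=
      Tendsto.limUnder_eq (by simpa using h0.add hw)
    calc iteratedLim 𝔘 (n + 1) (fun s => Φ fun j => z j (s j))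
        = limUnder (𝔘 : Filter I) fun i => G (z 0 i) := by
          refine congrArg (limUnder (𝔘 : Filter I)) (funext fun i => ?_)
          simp only [hcons z]
          exact iteratedLim_congr (Φ.curryLeft (z 0 i)) (fun j => z j.succ) (fun j => w j.succ)
            fun j => h j.succ
      _ = limUnder (𝔘 : Filter I) fun i => G (w 0 i) := hz
      _ = iteratedLim 𝔘 (n + 1) (fun s => Φ fun j => w j (s j)) := by
          refine congrArg (limUnder (𝔘 : Filter I)) (funext fun i => ?_)
          simp only [hcons w, G]

/-- The iterated extension of a continuous `n`-linear form to the ultrapower,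
`(z₁, …, zₙ) ↦ lim_{i₁,𝔘} ⋯ lim_{iₙ,𝔘} Φ (z₁ i₁, …, zₙ iₙ)`, the `zⱼ` being represented by
bounded families; the choice of these families is immaterial by `extendForm_mk` below. -/
def extendForm {n : ℕ} (Φ : ContinuousMultilinearMap 𝕜 (fun _ : Fin n => E) 𝕜)
    (z : Fin n → Ultrapower 𝕜 𝔘 E) : 𝕜 :=
  iteratedLim 𝔘 n fun s => Φ fun j => (Quotient.out (z j) : lp (fun _ : I => E) ∞) (s j)

/-- The iterated extension may be computed with any representing families. -/
theorem extendForm_mk {n : ℕ} (Φ : ContinuousMultilinearMap 𝕜 (fun _ : Fin n => E) 𝕜)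
    (w : Fin n → lp (fun _ : I => E) ∞) :
    extendForm 𝔘 Φ (fun j => (Submodule.Quotient.mk (w j) : Ultrapower 𝕜 𝔘 E)) =
      iteratedLim 𝔘 n fun s => Φ fun j => w j (s j) :=
  iteratedLim_congr 𝔘 Φ _ w fun _ =>
    (Submodule.Quotient.eq (nullFamilies 𝕜 𝔘 E)).1 (Quotient.out_eq _)

/-- The iterated extension of a continuous `n`-homogeneous polynomial to the ultrapower. -/
def iteratedExtension {n : ℕ} {P : E → 𝕜} (hP : P ∈ HomPoly 𝕜 n E) : Ultrapower 𝕜 𝔘 E → 𝕜 :=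
  fun z => extendForm 𝔘 (symmForm hP) fun _ => z

end Ultrapowers

/-! ### Banach ideals of homogeneous polynomials -/

/-- A Banach ideal of continuous scalar valued `n`-homogeneous polynomials, on the Banach spaces
over `𝕜` in the universe `u`. The values of `norm` matter only on the members of the ideal. -/
structure BanachPolyIdeal (𝕜 : Type) [RCLike 𝕜] (n : ℕ) where
  /-- The component of the ideal on a Banach space `E`. -/
  space : ∀ (E : Type u) [NormedAddCommGroup E] [NormedSpace 𝕜 E] [CompleteSpace E],
    Submodule 𝕜 (E → 𝕜)
  /-- The ideal norm on the component on `E`. -/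
  norm : ∀ (E : Type u) [NormedAddCommGroup E] [NormedSpace 𝕜 E] [CompleteSpace E],
    (E → 𝕜) → ℝ
  space_le : ∀ (E : Type u) [NormedAddCommGroup E] [NormedSpace 𝕜 E] [CompleteSpace E],
    space E ≤ HomPoly 𝕜 n E
  norm_add_le : ∀ (E : Type u) [NormedAddCommGroup E] [NormedSpace 𝕜 E] [CompleteSpace E],
    ∀ P ∈ space E, ∀ R ∈ space E, norm E (P + R) ≤ norm E P + norm E R
  norm_smul : ∀ (E : Type u) [NormedAddCommGroup E] [NormedSpace 𝕜 E] [CompleteSpace E],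
    ∀ (c : 𝕜), ∀ P ∈ space E, norm E (c • P) = ‖c‖ * norm E P
  eq_zero_of_norm_eq_zero :
    ∀ (E : Type u) [NormedAddCommGroup E] [NormedSpace 𝕜 E] [CompleteSpace E],
    ∀ P ∈ space E, norm E P = 0 → P = 0
  /-- Every Cauchy sequence of `space E` converges in `space E`. -/
  complete : ∀ (E : Type u) [NormedAddCommGroup E] [NormedSpace 𝕜 E] [CompleteSpace E],
    ∀ p : ℕ → E → 𝕜, (∀ k, p k ∈ space E) →
      (∀ ε > 0, ∃ N, ∀ k ≥ N, ∀ l ≥ N, norm E (p k - p l) < ε) →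
      ∃ P ∈ space E, Tendsto (fun k => norm E (p k - P)) atTop (𝓝 0)
  comp_mem : ∀ (E₁ E : Type u) [NormedAddCommGroup E₁] [NormedSpace 𝕜 E₁] [CompleteSpace E₁]
    [NormedAddCommGroup E] [NormedSpace 𝕜 E] [CompleteSpace E],
    ∀ (T : E₁ →L[𝕜] E), ∀ P ∈ space E, P ∘ T ∈ space E₁
  norm_comp_le : ∀ (E₁ E : Type u) [NormedAddCommGroup E₁] [NormedSpace 𝕜 E₁] [CompleteSpace E₁]
    [NormedAddCommGroup E] [NormedSpace 𝕜 E] [CompleteSpace E],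
    ∀ (T : E₁ →L[𝕜] E), ∀ P ∈ space E, norm E₁ (P ∘ T) ≤ norm E P * ‖T‖ ^ n
  /-- `z ↦ z ^ n` on the scalar field (lifted to the universe `u`) belongs to the ideal. -/
  pow_mem : (fun z : ULift.{u} 𝕜 => z.down ^ n) ∈ space (ULift.{u} 𝕜)
  norm_pow : norm (ULift.{u} 𝕜) (fun z => z.down ^ n) = 1

namespace BanachPolyIdeal

variable {𝕜 : Type} [RCLike 𝕜] {n : ℕ} (Q : BanachPolyIdeal.{u} 𝕜 n)
variable (E : Type u) [NormedAddCommGroup E] [NormedSpace 𝕜 E] [CompleteSpace E]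

/-- The numbers `‖R‖_{Q(F)} * ‖T‖ ^ n`, over all factorizations `P = R ∘ T` of `P` through a Banach
space `F` with `T : E → F` approximable and `R ∈ Q(F)`. -/
def minValues (P : E → 𝕜) : Set ℝ :=
  {r | ∃ (F : Type u) (_ : NormedAddCommGroup F) (_ : NormedSpace 𝕜 F) (_ : CompleteSpace F)
    (T : E →L[𝕜] F) (R : F → 𝕜), IsApproximable T ∧ R ∈ Q.space F ∧ P = R ∘ T ∧
      r = Q.norm F R * ‖T‖ ^ n}

/-- Membership in the component on `E` of the minimal kernel of `Q`: there is a factorization. -/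
def MemMin (P : E → 𝕜) : Prop := (Q.minValues E P).Nonempty

/-- The norm of the minimal kernel of `Q`. -/
def minNorm (P : E → 𝕜) : ℝ := sInf (Q.minValues E P)

/-- `Q` is minimal if it coincides with its minimal kernel, with equal norms. -/
def IsMinimal : Prop :=
  ∀ (E : Type u) [NormedAddCommGroup E] [NormedSpace 𝕜 E] [CompleteSpace E],
    (∀ P : E → 𝕜, P ∈ Q.space E ↔ Q.MemMin E P) ∧
    ∀ P ∈ Q.space E, Q.norm E P = Q.minNorm E P

end BanachPolyIdeal

end PolyIdeals

end

/-!
A compact operator `T : E → F` extends to an operator `S` on the ultrapower by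
`(z i) ↦ lim_𝔘 T (z i)`, with `‖S‖ ≤ ‖T‖`, and `S` is approximable when `T` is. Since the iterated
extension of `R ∘ T` is `R ∘ S`, a factorization of `P` through an approximable operator turns into
one of the iterated extension of `P`, at no greater cost. Conversely, `P` is recovered by
restricting its iterated extension along the isometric embedding of `E` as constant families. Both
polynomials thus have the same norm in the minimal kernel.
-/

namespace PolyIdeals

section IteratedLimits

variable {𝕜 : Type v} [RCLike 𝕜] {I : Type u} (𝔘 : Ultrafilter I)

theorem iteratedLim_eq_of_tendsto : ∀ {n : ℕ} {X : Fin n → Type*} [∀ j, TopologicalSpace (X j)]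
    {f : (∀ j, X j) → 𝕜} (_ : Continuous f) {w : ∀ j, I → X j} {x : ∀ j, X j}
    (_ : ∀ j, Tendsto (w j) 𝔘 (𝓝 (x j))),
    iteratedLim 𝔘 n (fun s => f fun j => w j (s j)) = f x
  | 0, _, _, f, _, _, _, _ => congrArg f (Subsingleton.elim _ _)
  | n + 1, X, _, f, hf, w, x, hw => by
    have inner (i : I) : iteratedLim 𝔘 n
        (fun s => f fun j => w j ((Fin.cons i s : Fin (n + 1) → I) j)) =
          f (Fin.cons (w 0 i) (Fin.tail x)) := by
      have hcons (s : Fin n → I) : (fun j => w j ((Fin.cons i s : Fin (n + 1) → I) j)) =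
          Fin.cons (w 0 i) fun j => w j.succ (s j) := by
        funext j
        cases j using Fin.cases <;> rfl
      simp only [hcons]
      exact iteratedLim_eq_of_tendsto
        (f := fun y => f (Fin.cons (w 0 i) y)) (hf.comp (continuous_const.finCons continuous_id))
        fun j => hw j.succ
    refine Tendsto.limUnder_eq ?_
    simp only [inner]
    have outer := (hf.tendsto _).comp ((hw 0).finCons (tendsto_const_nhds (x := Fin.tail x)))
    rwa [Fin.cons_self_tail] at outer

end IteratedLimits

section SymmForm

variable {𝕜 : Type v} [RCLike 𝕜] {n : ℕ}
variable {E : Type*} [NormedAddCommGroup E] [NormedSpace 𝕜 E]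
variable {F : Type*} [NormedAddCommGroup F] [NormedSpace 𝕜 F]

theorem isSymmForm_symmForm {P : E → 𝕜} (hP : P ∈ HomPoly 𝕜 n E) : IsSymmForm (symmForm hP) :=
  (existsUnique_symmForm hP).choose_spec.1.1

theorem symmForm_apply_diagonal {P : E → 𝕜} (hP : P ∈ HomPoly 𝕜 n E) (x : E) :
    symmForm hP (fun _ => x) = P x :=
  (existsUnique_symmForm hP).choose_spec.1.2 x

theorem comp_mem_homPoly {R : F → 𝕜} (hR : R ∈ HomPoly 𝕜 n F) (T : E →L[𝕜] F) :
    R ∘ T ∈ HomPoly 𝕜 n E := by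
  obtain ⟨A, rfl⟩ := hR
  exact ⟨A.compContinuousLinearMap fun _ => T, rfl⟩

theorem symmForm_comp {R : F → 𝕜} (hR : R ∈ HomPoly 𝕜 n F) (T : E →L[𝕜] F) :
    symmForm (comp_mem_homPoly hR T) = (symmForm hR).compContinuousLinearMap fun _ => T :=
  (existsUnique_symmForm (comp_mem_homPoly hR T)).unique
    ⟨isSymmForm_symmForm _, symmForm_apply_diagonal _⟩
    ⟨fun σ x => isSymmForm_symmForm hR σ fun j => T (x j),
      fun x => symmForm_apply_diagonal hR (T x)⟩

theorem iteratedLim_symmForm_of_tendsto {I : Type*} (𝔘 : Ultrafilter I) {P : E → 𝕜}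
    (hP : P ∈ HomPoly 𝕜 n E) {z : I → E} {x : E} (hz : Tendsto z 𝔘 (𝓝 x)) :
    iteratedLim 𝔘 n (fun s => symmForm hP fun j => z (s j)) = P x :=
  (iteratedLim_eq_of_tendsto 𝔘 (symmForm hP).cont fun _ => hz).trans
    (symmForm_apply_diagonal hP x)

end SymmForm

section Approximable

variable {𝕜 : Type v} [RCLike 𝕜]

theorem isCompactOperator_of_finiteDimensional_range {E F : Type*}
    [NormedAddCommGroup E] [NormedSpace 𝕜 E] [NormedAddCommGroup F] [NormedSpace 𝕜 F]
    (T : E →L[𝕜] F) [FiniteDimensional 𝕜 (LinearMap.range (T : E →ₗ[𝕜] F))] :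
    IsCompactOperator T := by
  have := FiniteDimensional.proper 𝕜 (LinearMap.range (T : E →ₗ[𝕜] F))
  exact (isCompactOperator_of_locallyCompactSpace_dom T.rangeRestrict).clm_comp
    (Submodule.subtypeL _)

variable {E F : Type u} [NormedAddCommGroup E] [NormedSpace 𝕜 E]
variable [NormedAddCommGroup F] [NormedSpace 𝕜 F]

theorem IsApproximable.isCompactOperator [CompleteSpace F] {T : E →L[𝕜] F}
    (hT : IsApproximable T) : IsCompactOperator T := by
  refine closure_minimal (fun S hS => ?_) isClosed_setOfPred_isCompactOperator hT
  have : FiniteDimensional 𝕜 (LinearMap.range (S : E →ₗ[𝕜] F)) := hS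
  exact isCompactOperator_of_finiteDimensional_range S

theorem IsApproximable.comp {D : Type u} [NormedAddCommGroup D] [NormedSpace 𝕜 D]
    {T : E →L[𝕜] F} (hT : IsApproximable T) (S : D →L[𝕜] E) : IsApproximable (T ∘L S) := by
  refine map_mem_closure (f := fun T' : E →L[𝕜] F => T' ∘L S)
    (continuous_id.clm_comp continuous_const) hT fun T' hT' => ?_
  have : FiniteDimensional 𝕜 (LinearMap.range (T' : E →ₗ[𝕜] F)) := hT'
  exact Submodule.finiteDimensional_of_le (LinearMap.range_comp_le_range (S : D →ₗ[𝕜] E) _)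

end Approximable

section CanonicalEmbedding

variable {𝕜 : Type v} [RCLike 𝕜] {I : Type u} (𝔘 : Ultrafilter I)
variable {E : Type u} [NormedAddCommGroup E] [NormedSpace 𝕜 E]

variable (𝕜 I E) in
/-- The embedding of `E` into the bounded families in `E`, as constant families. -/
noncomputable def constFamily : E →ₗ[𝕜] lp (fun _ : I => E) ∞ where
  toFun x := ⟨fun _ => x, memℓp_infty Set.finite_range_const.bddAbove⟩
  map_add' _ _ := rfl
  map_smul' _ _ := rfl

variable (𝕜 E) in
/-- The canonical isometric embedding of `E` into its ultrapower, by classes of constant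
families. -/
noncomputable def canonicalEmbedding : E →ₗᵢ[𝕜] Ultrapower 𝕜 𝔘 E where
  toLinearMap := (nullFamilies 𝕜 𝔘 E).mkQ ∘ₗ constFamily 𝕜 I E
  norm_map' x := tendsto_nhds_unique (tendsto_norm_mk 𝔘 (constFamily 𝕜 I E x)) tendsto_const_nhds

theorem iteratedExtension_mk {n : ℕ} {P : E → 𝕜} (hP : P ∈ HomPoly 𝕜 n E)
    (z : lp (fun _ : I => E) ∞) :
    iteratedExtension 𝔘 hP (Submodule.Quotient.mk z) =
      iteratedLim 𝔘 n fun s => symmForm hP fun j => z (s j) :=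
  extendForm_mk 𝔘 (symmForm hP) fun _ => z

theorem iteratedExtension_comp_canonicalEmbedding {n : ℕ} {P : E → 𝕜} (hP : P ∈ HomPoly 𝕜 n E) :
    iteratedExtension 𝔘 hP ∘ canonicalEmbedding 𝕜 𝔘 E = P :=
  funext fun x => (iteratedExtension_mk 𝔘 hP (constFamily 𝕜 I E x)).trans
    (iteratedLim_symmForm_of_tendsto 𝔘 hP tendsto_const_nhds)

end CanonicalEmbedding

section CompactExtension

variable {𝕜 : Type v} [RCLike 𝕜] {I : Type u} (𝔘 : Ultrafilter I)
variable {E : Type u} [NormedAddCommGroup E] [NormedSpace 𝕜 E]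
variable {F : Type*} [NormedAddCommGroup F] [NormedSpace 𝕜 F]

theorem tendsto_limUnder_of_isCompactOperator {T : E →L[𝕜] F} (hT : IsCompactOperator T)
    (z : lp (fun _ : I => E) ∞) :
    Tendsto (fun i => T (z i)) 𝔘 (𝓝 (limUnder (𝔘 : Filter I) fun i => T (z i))) := by
  have hmem (i : I) : T (z i) ∈ closure (T '' Metric.closedBall 0 ‖z‖) :=
    subset_closure ⟨z i, by simpa using lp.norm_apply_le_norm (by simp) z i, rfl⟩
  have hK : IsCompact (closure (T '' Metric.closedBall 0 ‖z‖)) :=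
    hT.isCompact_closure_image_closedBall (f := (T : E →ₗ[𝕜] F)) ‖z‖
  obtain ⟨y, -, hy⟩ :=
    hK.ultrafilter_le_nhds' (𝔘.map fun i => T (z i)) (mem_map.2 (univ_mem' hmem))
  exact tendsto_nhds_limUnder ⟨y, hy⟩

/-- The map `z ↦ lim_𝔘 T (z i)` on bounded families, for a compact operator `T`. It is the lift of
`compactExtension` below to representing families. -/
noncomputable def limOfIsCompactOperator {T : E →L[𝕜] F} (hT : IsCompactOperator T) :
    lp (fun _ : I => E) ∞ →ₗ[𝕜] F where
  toFun z := limUnder (𝔘 : Filter I) fun i => T (z i)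
  map_add' z w := Tendsto.limUnder_eq <| by
    simpa using (tendsto_limUnder_of_isCompactOperator 𝔘 hT z).add
      (tendsto_limUnder_of_isCompactOperator 𝔘 hT w)
  map_smul' c z := Tendsto.limUnder_eq <| by
    simpa using (tendsto_limUnder_of_isCompactOperator 𝔘 hT z).const_smul c

theorem nullFamilies_le_ker_limOfIsCompactOperator {T : E →L[𝕜] F} (hT : IsCompactOperator T) :
    nullFamilies 𝕜 𝔘 E ≤ LinearMap.ker (limOfIsCompactOperator 𝔘 hT) := fun z hz => by
  have hz₀ : Tendsto (fun i => z i) 𝔘 (𝓝 0) := tendsto_zero_iff_norm_tendsto_zero.2 hz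
  exact Tendsto.limUnder_eq (by simpa [Function.comp_def] using (T.continuous.tendsto 0).comp hz₀)

/-- The extension of a compact operator `T : E → F` to the ultrapower of `E`,
`(z i) ↦ lim_𝔘 T (z i)`. -/
noncomputable def compactExtension {T : E →L[𝕜] F} (hT : IsCompactOperator T) :
    Ultrapower 𝕜 𝔘 E →L[𝕜] F :=
  LinearMap.mkContinuous
    ((nullFamilies 𝕜 𝔘 E).liftQ (limOfIsCompactOperator 𝔘 hT)
      (nullFamilies_le_ker_limOfIsCompactOperator 𝔘 hT)) ‖T‖ <|
    (Submodule.Quotient.mk_surjective _).forall.2 fun z =>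
      le_of_tendsto_of_tendsto' (tendsto_limUnder_of_isCompactOperator 𝔘 hT z).norm
        ((tendsto_norm_mk 𝔘 z).const_mul ‖T‖) fun i => T.le_opNorm (z i)

theorem tendsto_compactExtension {T : E →L[𝕜] F} (hT : IsCompactOperator T)
    (z : lp (fun _ : I => E) ∞) :
    Tendsto (fun i => T (z i)) 𝔘 (𝓝 (compactExtension 𝔘 hT (Submodule.Quotient.mk z))) :=
  tendsto_limUnder_of_isCompactOperator 𝔘 hT z

theorem norm_compactExtension_le {T : E →L[𝕜] F} (hT : IsCompactOperator T) :
    ‖compactExtension 𝔘 hT‖ ≤ ‖T‖ :=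
  LinearMap.mkContinuous_norm_le _ (norm_nonneg T) _

theorem compactExtension_sub {S T : E →L[𝕜] F} (hS : IsCompactOperator S)
    (hT : IsCompactOperator T) (hST : IsCompactOperator (S - T : E →L[𝕜] F)) :
    compactExtension 𝔘 hST = compactExtension 𝔘 hS - compactExtension 𝔘 hT :=
  ContinuousLinearMap.ext <| (Submodule.Quotient.mk_surjective _).forall.2 fun z =>
    tendsto_nhds_unique (tendsto_compactExtension 𝔘 hST z)
      ((tendsto_compactExtension 𝔘 hS z).sub (tendsto_compactExtension 𝔘 hT z))

theorem range_compactExtension_le {T : E →L[𝕜] F} (hT : IsCompactOperator T) :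
    LinearMap.range (compactExtension 𝔘 hT : Ultrapower 𝕜 𝔘 E →ₗ[𝕜] F) ≤
      (LinearMap.range (T : E →ₗ[𝕜] F)).topologicalClosure := by
  rintro _ ⟨x, rfl⟩
  obtain ⟨z, rfl⟩ := Submodule.Quotient.mk_surjective _ x
  exact mem_closure_of_tendsto (tendsto_compactExtension 𝔘 hT z)
    (Eventually.of_forall fun i => ⟨z i, rfl⟩)

theorem finiteDimensional_range_compactExtension {T : E →L[𝕜] F} (hT : IsCompactOperator T)
    [FiniteDimensional 𝕜 (LinearMap.range (T : E →ₗ[𝕜] F))] :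
    FiniteDimensional 𝕜
      (LinearMap.range (compactExtension 𝔘 hT : Ultrapower 𝕜 𝔘 E →ₗ[𝕜] F)) := by
  have hle := range_compactExtension_le 𝔘 hT
  rw [(Submodule.closed_of_finiteDimensional _).submodule_topologicalClosure_eq] at hle
  exact Submodule.finiteDimensional_of_le hle

theorem IsApproximable.compactExtension {F : Type u} [NormedAddCommGroup F] [NormedSpace 𝕜 F]
    {T : E →L[𝕜] F} (hT : IsApproximable T) (hTc : IsCompactOperator T) :
    IsApproximable (compactExtension 𝔘 hTc) := by
  refine Metric.mem_closure_iff.2 fun ε hε => ?_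
  obtain ⟨S, hS, hTS⟩ := Metric.mem_closure_iff.1 hT ε hε
  have : FiniteDimensional 𝕜 (LinearMap.range (S : E →ₗ[𝕜] F)) := hS
  have hSc := isCompactOperator_of_finiteDimensional_range S
  refine ⟨PolyIdeals.compactExtension 𝔘 hSc, finiteDimensional_range_compactExtension 𝔘 hSc, ?_⟩
  rw [dist_eq_norm, ← compactExtension_sub 𝔘 hTc hSc (hTc.sub hSc)]
  exact (norm_compactExtension_le 𝔘 _).trans_lt (dist_eq_norm T S ▸ hTS)

theorem iteratedExtension_comp {n : ℕ} {R : F → 𝕜} (hR : R ∈ HomPoly 𝕜 n F) {T : E →L[𝕜] F}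
    (hT : IsCompactOperator T) :
    iteratedExtension 𝔘 (comp_mem_homPoly hR T) = R ∘ compactExtension 𝔘 hT := by
  funext x
  obtain ⟨z, rfl⟩ := Submodule.Quotient.mk_surjective _ x
  rw [iteratedExtension_mk, symmForm_comp]
  exact iteratedLim_symmForm_of_tendsto 𝔘 hR (tendsto_compactExtension 𝔘 hT z)

end CompactExtension

namespace BanachPolyIdeal

variable {𝕜 : Type} [RCLike 𝕜] {n : ℕ} {Q : BanachPolyIdeal.{u} 𝕜 n}
variable {E F : Type u} [NormedAddCommGroup E] [NormedSpace 𝕜 E]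
variable [NormedAddCommGroup F] [NormedSpace 𝕜 F]

theorem norm_nonneg [CompleteSpace E] {P : E → 𝕜} (hP : P ∈ Q.space E) : 0 ≤ Q.norm E P := by
  have hzero : Q.norm E 0 = 0 := by simpa using Q.norm_smul E 0 P hP
  have hneg : Q.norm E (-P) = Q.norm E P := by simpa using Q.norm_smul E (-1) P hP
  have hadd : Q.norm E (P + -P) ≤ Q.norm E P + Q.norm E (-P) :=
    Q.norm_add_le E P hP (-P) (neg_mem hP)
  rw [add_neg_cancel, hzero, hneg] at hadd
  linarith

theorem nonneg_of_mem_minValues {P : E → 𝕜} {r : ℝ} (hr : r ∈ Q.minValues E P) : 0 ≤ r := by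
  obtain ⟨F, _, _, _, T, R, -, hR, -, rfl⟩ := hr
  exact mul_nonneg (norm_nonneg hR) (by positivity)

theorem minNorm_nonneg (P : E → 𝕜) : 0 ≤ Q.minNorm E P :=
  Real.sInf_nonneg fun _ => nonneg_of_mem_minValues

theorem minNorm_le_of_mem_minValues {P : E → 𝕜} {r : ℝ} (hr : r ∈ Q.minValues E P) :
    Q.minNorm E P ≤ r :=
  csInf_le ⟨0, fun _ => nonneg_of_mem_minValues⟩ hr

theorem mul_norm_pow_mem_minValues [CompleteSpace F] {T : E →L[𝕜] F} (hT : IsApproximable T)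
    {R : F → 𝕜} (hR : R ∈ Q.space F) : Q.norm F R * ‖T‖ ^ n ∈ Q.minValues E (R ∘ T) :=
  ⟨F, _, _, _, T, R, hT, hR, rfl, rfl⟩

theorem MemMin.mem_homPoly {P : E → 𝕜} (hP : Q.MemMin E P) : P ∈ HomPoly 𝕜 n E := by
  obtain ⟨_, F, _, _, _, T, R, -, hR, rfl, -⟩ := hP
  exact comp_mem_homPoly (Q.space_le F hR) T

theorem minNorm_comp_le {P : F → 𝕜} (hP : Q.MemMin F P) (T : E →L[𝕜] F) :
    Q.minNorm E (P ∘ T) ≤ Q.minNorm F P * ‖T‖ ^ n := by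
  have hle : ∀ r ∈ Q.minValues F P, Q.minNorm E (P ∘ T) ≤ ‖T‖ ^ n * r := by
    rintro _ ⟨G, _, _, _, S, R, hS, hR, rfl, rfl⟩
    calc Q.minNorm E (R ∘ (S ∘L T)) ≤ Q.norm G R * ‖S ∘L T‖ ^ n :=
          minNorm_le_of_mem_minValues (mul_norm_pow_mem_minValues (hS.comp T) hR)
      _ ≤ Q.norm G R * (‖S‖ * ‖T‖) ^ n := by
          gcongr
          · exact norm_nonneg hR
          · exact S.opNorm_comp_le T
      _ = ‖T‖ ^ n * (Q.norm G R * ‖S‖ ^ n) := by ring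
  rw [mul_comm, minNorm, minNorm, ← smul_eq_mul, ← Real.sInf_smul_of_nonneg (by positivity)]
  exact le_csInf (hP.image _) (Set.forall_mem_image.2 hle)

variable {I : Type u} (𝔘 : Ultrafilter I)

theorem exists_mem_minValues_iteratedExtension_le {P : E → 𝕜} (hP : P ∈ HomPoly 𝕜 n E) {r : ℝ}
    (hr : r ∈ Q.minValues E P) :
    ∃ r' ∈ Q.minValues (Ultrapower 𝕜 𝔘 E) (iteratedExtension 𝔘 hP), r' ≤ r := by
  obtain ⟨F, _, _, _, T, R, hT, hR, rfl, rfl⟩ := hr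
  have hTc := hT.isCompactOperator
  rw [iteratedExtension_comp 𝔘 (Q.space_le F hR) hTc]
  refine ⟨_, mul_norm_pow_mem_minValues (hT.compactExtension 𝔘 hTc) hR, ?_⟩
  gcongr
  · exact norm_nonneg hR
  · exact norm_compactExtension_le 𝔘 hTc

theorem MemMin.iteratedExtension {P : E → 𝕜} (hP : Q.MemMin E P) :
    Q.MemMin (Ultrapower 𝕜 𝔘 E) (iteratedExtension 𝔘 hP.mem_homPoly) :=
  let ⟨_, hr⟩ := hP
  let ⟨r', hr', _⟩ := exists_mem_minValues_iteratedExtension_le 𝔘 hP.mem_homPoly hr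
  ⟨r', hr'⟩

theorem minNorm_iteratedExtension_le {P : E → 𝕜} (hP : Q.MemMin E P) :
    Q.minNorm (Ultrapower 𝕜 𝔘 E) (iteratedExtension 𝔘 hP.mem_homPoly) ≤ Q.minNorm E P :=
  le_csInf hP fun _ hr =>
    let ⟨_, hr', hle⟩ := exists_mem_minValues_iteratedExtension_le 𝔘 hP.mem_homPoly hr
    (minNorm_le_of_mem_minValues hr').trans hle

theorem le_minNorm_iteratedExtension {P : E → 𝕜} (hP : Q.MemMin E P) :
    Q.minNorm E P ≤ Q.minNorm (Ultrapower 𝕜 𝔘 E) (iteratedExtension 𝔘 hP.mem_homPoly) := by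
  set J := (canonicalEmbedding 𝕜 𝔘 E).toContinuousLinearMap
  set P' := PolyIdeals.iteratedExtension 𝔘 hP.mem_homPoly
  calc Q.minNorm E P = Q.minNorm E (P' ∘ J) :=
        congrArg (Q.minNorm E) (iteratedExtension_comp_canonicalEmbedding 𝔘 hP.mem_homPoly).symm
    _ ≤ Q.minNorm _ P' * ‖J‖ ^ n := minNorm_comp_le (hP.iteratedExtension 𝔘) J
    _ ≤ Q.minNorm _ P' := mul_le_of_le_one_right (minNorm_nonneg P') <|
        pow_le_one₀ (_root_.norm_nonneg J) (canonicalEmbedding 𝕜 𝔘 E).norm_toContinuousLinearMap_le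

end BanachPolyIdeal

end PolyIdeals

open PolyIdeals in
theorem theorem3p7_general {𝕜 : Type} [RCLike 𝕜] {n : ℕ} (Q : BanachPolyIdeal.{u} 𝕜 n)
    {E : Type u} [NormedAddCommGroup E] [NormedSpace 𝕜 E]
    {I : Type u} (𝔘 : Ultrafilter I) {P : E → 𝕜} (hP : Q.MemMin E P) :
    Q.MemMin (Ultrapower 𝕜 𝔘 E) (iteratedExtension 𝔘 hP.mem_homPoly) ∧
      Q.minNorm E P = Q.minNorm (Ultrapower 𝕜 𝔘 E) (iteratedExtension 𝔘 hP.mem_homPoly) :=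
  ⟨hP.iteratedExtension 𝔘,
    (BanachPolyIdeal.le_minNorm_iteratedExtension 𝔘 hP).antisymm
      (BanachPolyIdeal.minNorm_iteratedExtension_le 𝔘 hP)⟩

theorem theorem3p7 {𝕜 : Type} [RCLike 𝕜] {n : ℕ} (Q : PolyIdeals.BanachPolyIdeal.{u} 𝕜 n)
    (hQ : Q.IsMinimal)
    {E : Type u} [NormedAddCommGroup E] [NormedSpace 𝕜 E] [CompleteSpace E]
    {I : Type u} (𝔘 : Ultrafilter I) {P : E → 𝕜} (hP : P ∈ Q.space E) :
    PolyIdeals.iteratedExtension 𝔘 (Q.space_le E hP) ∈ Q.space (PolyIdeals.Ultrapower 𝕜 𝔘 E) ∧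
      Q.norm E P = Q.norm (PolyIdeals.Ultrapower 𝕜 𝔘 E)
        (PolyIdeals.iteratedExtension 𝔘 (Q.space_le E hP)) := by
  obtain ⟨hmin, hnorm⟩ := theorem3p7_general Q 𝔘 (((hQ E).1 P).1 hP)
  have hmem := ((hQ (PolyIdeals.Ultrapower 𝕜 𝔘 E)).1 _).2 hmin
  exact ⟨hmem, by rw [(hQ E).2 P hP, hnorm, (hQ (PolyIdeals.Ultrapower 𝕜 𝔘 E)).2 _ hmem]⟩
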